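/- For a finite group $G$, let $B(G)$ be its Burnside ring, and for $U\leqslant G$ let $x\mapsto |x^U|$ be the ring homomorphism $B(G)\to\mathbb{Z}$ extending $[X]\mapsto|X^U|$. Let $C$ be a cyclic group of order $|G|$, and for a subgroup $H\leqslant G$ let $C_H$ denote the subgroup of $C$ of order $|H|$. The Frobenius–Wielandt (FW) morphism $\alpha^G:B(C)\to B(G)$ is the unique ring homomorphism such that $|\alpha^G(x)^U|=|x^{C_U}|$ for all $x\in B(C)$ and all $U\leqslant G$. For a normal subgroup $N$ of $G$, the deflation $\mathrm{Def}^G_{G/N}:B(G)\to B(G/N)$ is the additive map sending the class of a finite $G$-set $X$ to the class of the $G/N$-set of $N$-orbits of $X$. We say that, for $G$ and $N$, the FW morphism commutes with $\mathrm{Def}^G_{G/N}$ if $$\mathrm{Def}^G_{G/N}\circ\alpha^G=\alpha^{G/N}\circ\mathrm{Def}^C_{C/C_N},$$ where $C/C_N$ is taken as the cyclic group of order $|G/N|$ in the definition of $\alpha^{G/N}:B(C/C_N)\to B(G/N)$. **Proposition.** Let $G$ be a finite group and $N$ a normal subgroup of $G$. If for $G$ and $N$ the FW morphism commutes with $\mathrm{Def}^G_{G/N}$,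 then for every subgroup $T$ of $G$ containing $N$ the FW morphism commutes with $\mathrm{Def}^T_{T/N}$; that is, $$\mathrm{Def}^T_{T/N}\circ\alpha^T=\alpha^{T/N}\circ\mathrm{Def}^{C_T}_{C_T/C_N},$$ with $C_T$ as the cyclic group of order $|T|$ and $C_T/C_N$ as the cyclic group of order $|T/N|$. -/

import Mathlib

universe u v

/-- A finite (left) `G`-set. -/
structure FinGSet (G : Type u) [Group G] where
  carrier : Type u
  [action : MulAction G carrier]
  [finite : Finite carrier]

namespace FinGSet

attribute [instance] FinGSet.action FinGSet.finite

variable {G : Type u} [Group G]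

/-- Isomorphism of finite `G`-sets: an equivariant bijection exists. -/
def Iso (X Y : FinGSet G) : Prop :=
  ∃ e : X.carrier ≃ Y.carrier, ∀ (g : G) (x : X.carrier), e (g • x) = g • e x

theorem Iso.refl (X : FinGSet G) : Iso X X := ⟨Equiv.refl _, fun _ _ => rfl⟩

theorem Iso.symm {X Y : FinGSet G} : Iso X Y → Iso Y X := fun ⟨e, he⟩ =>
  ⟨e.symm, fun g y => by rw [Equiv.symm_apply_eq, he, Equiv.apply_symm_apply]⟩

theorem Iso.trans {X Y Z : FinGSet G} : Iso X Y → Iso Y Z → Iso X Z := fun ⟨e, he⟩ ⟨f, hf⟩ =>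
  ⟨e.trans f, fun g x => by simp [he, hf]⟩

instance setoid (G : Type u) [Group G] : Setoid (FinGSet G) where
  r := Iso
  iseqv := ⟨Iso.refl, Iso.symm, Iso.trans⟩

/-- The disjoint union of two finite `G`-sets. -/
def sum (X Y : FinGSet G) : FinGSet G := ⟨X.carrier ⊕ Y.carrier⟩

/-- The product of two finite `G`-sets, with the diagonal action. -/
def prod (X Y : FinGSet G) : FinGSet G := ⟨X.carrier × Y.carrier⟩

/-- The one-point `G`-set. -/
def point (G : Type u) [Group G] : FinGSet G := ⟨PUnit⟩

/-- The number `|X^U|` of points of `X` fixed by the subgroup `U`. -/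
noncomputable def mark (U : Subgroup G) (X : FinGSet G) : ℕ :=
  Nat.card (MulAction.fixedPoints U X.carrier)

/-- The `G`-set carried by a `G`-stable subset of `X`. -/
def sub (X : FinGSet G) (S : SubMulAction G X.carrier) : FinGSet G := ⟨S⟩

theorem mark_congr (U : Subgroup G) {X Y : FinGSet G} (h : Iso X Y) : mark U X = mark U Y := by
  obtain ⟨e, he⟩ := h
  refine Nat.card_congr (e.subtypeEquiv fun x => ?_)
  simp only [MulAction.mem_fixedPoints, Subgroup.smul_def]
  exact forall_congr' fun u => by rw [← he, e.apply_eq_iff_eq]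

theorem mark_sum (U : Subgroup G) (X Y : FinGSet G) :
    mark U (X.sum Y) = mark U X + mark U Y := by
  unfold mark
  rw [← Nat.card_sum]
  refine Nat.card_congr ((Equiv.subtypeSum).trans (Equiv.sumCongr ?_ ?_))
  · refine Equiv.subtypeEquivRight fun x => ?_
    simp only [MulAction.mem_fixedPoints, Subgroup.smul_def]
    exact forall_congr' fun u => Sum.inl_injective.eq_iff
  · refine Equiv.subtypeEquivRight fun x => ?_
    simp only [MulAction.mem_fixedPoints, Subgroup.smul_def]
    exact forall_congr' fun u => Sum.inr_injective.eq_iff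

theorem mark_prod (U : Subgroup G) (X Y : FinGSet G) :
    mark U (X.prod Y) = mark U X * mark U Y := by
  unfold mark
  rw [← Nat.card_prod]
  refine Nat.card_congr
    { toFun := fun z => (⟨z.1.1, fun u => congrArg Prod.fst (z.2 u)⟩,
        ⟨z.1.2, fun u => congrArg Prod.snd (z.2 u)⟩)
      invFun := fun z => ⟨(z.1.1, z.2.1), fun u => Prod.ext (z.1.2 u) (z.2.2 u)⟩
      left_inv := fun _ => rfl
      right_inv := fun _ => rfl }

theorem mark_point (U : Subgroup G) : mark U (point G) = 1 := by
  unfold mark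
  have : MulAction.fixedPoints U (point G).carrier = Set.univ :=
    Set.eq_univ_of_forall fun x u => rfl
  rw [this, Nat.card_univ]
  exact Nat.card_unique (α := PUnit)

/-- The commutative monoid of isomorphism classes of finite `G`-sets under the product. -/
abbrev IsoClass (G : Type u) [Group G] := Quotient (FinGSet.setoid G)

instance : CommMonoid (IsoClass G) where
  mul := Quotient.map₂ prod (by
    rintro X X' ⟨e, he⟩ Y Y' ⟨f, hf⟩
    exact ⟨Equiv.prodCongr e f, fun g x => Prod.ext (he g x.1) (hf g x.2)⟩)
  one := ⟦point G⟧
  mul_assoc := by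
    rintro ⟨X⟩ ⟨Y⟩ ⟨Z⟩
    exact Quotient.sound ⟨Equiv.prodAssoc _ _ _, fun _ _ => rfl⟩
  one_mul := by
    rintro ⟨X⟩
    exact Quotient.sound ⟨Equiv.punitProd _, fun _ _ => rfl⟩
  mul_one := by
    rintro ⟨X⟩
    exact Quotient.sound ⟨Equiv.prodPUnit _, fun _ _ => rfl⟩
  mul_comm := by
    rintro ⟨X⟩ ⟨Y⟩
    exact Quotient.sound ⟨Equiv.prodComm _ _, fun _ _ => rfl⟩

end FinGSet

/-- The relations `[X ⊔ Y] = [X] + [Y]`. -/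
def burnsideRelations (G : Type u) [Group G] : Ideal (FreeAbelianGroup (FinGSet.IsoClass G)) :=
  Ideal.span {r | ∃ X Y : FinGSet G, r = FreeAbelianGroup.of ⟦X.sum Y⟧ -
    (FreeAbelianGroup.of ⟦X⟧ + FreeAbelianGroup.of ⟦Y⟧)}

/-- The Burnside ring `B(G)`: the Grothendieck ring of isomorphism classes of finite `G`-sets, with
addition induced by disjoint union and multiplication induced by the product. -/
abbrev BurnsideRing (G : Type u) [Group G] :=
  FreeAbelianGroup (FinGSet.IsoClass G) ⧸ burnsideRelations G

namespace BurnsideRing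

open FinGSet

variable {G : Type u} [Group G]

/-- The class `[X]` in the Burnside ring. -/
def of (X : FinGSet G) : BurnsideRing G :=
  Ideal.Quotient.mk (burnsideRelations G) (FreeAbelianGroup.of ⟦X⟧)

theorem of_congr {X Y : FinGSet G} (h : Iso X Y) : of X = of Y := by
  unfold of
  rw [Quotient.sound (s := FinGSet.setoid G) h]

theorem of_sum (X Y : FinGSet G) : of (X.sum Y) = of X + of Y := by
  unfold of
  rw [← map_add, Ideal.Quotient.eq]
  exact Ideal.subset_span ⟨X, Y, rfl⟩

theorem of_prod (X Y : FinGSet G) : of (X.prod Y) = of X * of Y := by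
  unfold of
  rw [← map_mul, FreeAbelianGroup.of_mul_of]
  rfl

theorem of_point : of (point G) = 1 := rfl

theorem relations_le_ker {A : Type*} [AddCommGroup A] (f : FinGSet G → A)
    (hf : ∀ X Y, Iso X Y → f X = f Y) (hadd : ∀ X Y, f (X.sum Y) = f X + f Y)
    (x : FreeAbelianGroup (IsoClass G)) (hx : x ∈ burnsideRelations G) :
    FreeAbelianGroup.lift (Quotient.lift f hf) x = 0 := by
  have key : ∀ r ∈ {r | ∃ X Y : FinGSet G, r = FreeAbelianGroup.of ⟦X.sum Y⟧ -
      (FreeAbelianGroup.of ⟦X⟧ + FreeAbelianGroup.of ⟦Y⟧)}, ∀ a : FreeAbelianGroup (IsoClass G),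
      FreeAbelianGroup.lift (Quotient.lift f hf) (a * r) = 0 := by
    rintro _ ⟨X, Y, rfl⟩ a
    induction a using FreeAbelianGroup.induction_on with
    | zero => rw [zero_mul, map_zero]
    | of Z =>
      obtain ⟨Z, rfl⟩ := Quotient.exists_rep Z
      rw [mul_sub, mul_add, map_sub, map_add]
      simp only [FreeAbelianGroup.of_mul_of, FreeAbelianGroup.lift_apply_of]
      change f (Z.prod (X.sum Y)) - (f (Z.prod X) + f (Z.prod Y)) = 0
      rw [← hadd, sub_eq_zero]
      refine hf _ _ ⟨Equiv.prodSumDistrib _ _ _, ?_⟩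
      rintro g ⟨z, x | y⟩ <;> rfl
    | neg Z h => rw [neg_mul, map_neg, h, neg_zero]
    | add a b ha hb => rw [add_mul, map_add, ha, hb, add_zero]
  refine Submodule.span_induction
    (p := fun y _ => ∀ a, FreeAbelianGroup.lift (Quotient.lift f hf) (a * y) = 0)
    key ?_ ?_ ?_ hx 1 |> fun h => by rwa [one_mul] at h
  · intro a; rw [mul_zero, map_zero]
  · intro y z _ _ hy hz a; rw [mul_add, map_add, hy, hz, add_zero]
  · intro b y _ hy a; rw [smul_eq_mul, ← mul_assoc, hy]

/-- A map on finite `G`-sets that is invariant under isomorphism and turns disjoint unions into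
sums extends to an additive map on the Burnside ring. -/
def liftAdd {A : Type*} [AddCommGroup A] (f : FinGSet G → A)
    (hf : ∀ X Y, Iso X Y → f X = f Y) (hadd : ∀ X Y, f (X.sum Y) = f X + f Y) :
    BurnsideRing G →+ A :=
  QuotientAddGroup.lift (burnsideRelations G).toAddSubgroup
    (FreeAbelianGroup.lift (Quotient.lift f hf)) (relations_le_ker f hf hadd)

theorem liftAdd_of {A : Type*} [AddCommGroup A] (f : FinGSet G → A)
    (hf : ∀ X Y, Iso X Y → f X = f Y) (hadd : ∀ X Y, f (X.sum Y) = f X + f Y) (X : FinGSet G) :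
    liftAdd f hf hadd (of X) = f X :=
  FreeAbelianGroup.lift_apply_of _ _

/-- The ring homomorphism `x ↦ |x^U|` from `B(G)` to `ℤ`, extending `X ↦ |X^U|`. -/
noncomputable def mark (U : Subgroup G) : BurnsideRing G →+* ℤ :=
  Ideal.Quotient.lift (burnsideRelations G)
    (FreeAbelianGroup.liftMonoid
      { toFun := Quotient.lift (fun X => (FinGSet.mark U X : ℤ))
          fun X Y h => congrArg Nat.cast (mark_congr U h)
        map_one' := congrArg Nat.cast (mark_point U)
        map_mul' := by
          rintro ⟨X⟩ ⟨Y⟩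
          exact (congrArg Nat.cast (mark_prod U X Y)).trans (Nat.cast_mul _ _) })
    (relations_le_ker (fun X => (FinGSet.mark U X : ℤ)) (fun X Y h => congrArg Nat.cast (mark_congr U h))
      fun X Y => (congrArg Nat.cast (mark_sum U X Y)).trans (Nat.cast_add _ _))

theorem mark_of (U : Subgroup G) (X : FinGSet G) : mark U (of X) = FinGSet.mark U X :=
  FreeAbelianGroup.lift_apply_of
    (Quotient.lift (fun X => (FinGSet.mark U X : ℤ)) fun _ _ h => congrArg Nat.cast (mark_congr U h))
    ⟦X⟧

theorem of_isEmpty (X : FinGSet G) [h : IsEmpty X.carrier] : of X = 0 := by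
  have h1 := of_sum X X
  rw [of_congr (Y := X) ⟨Equiv.sumEmpty _ _, by rintro g (x | x) <;> exact h.elim x⟩] at h1
  simpa using h1

/-- Every element of the Burnside ring is a difference of two classes. -/
theorem exists_sub (x : BurnsideRing G) : ∃ X Y : FinGSet G, x = of X - of Y := by
  obtain ⟨a, rfl⟩ := Ideal.Quotient.mk_surjective x
  induction a using FreeAbelianGroup.induction_on with
  | zero => exact ⟨point G, point G, by simp⟩
  | of Z =>
    obtain ⟨Z, rfl⟩ := Quotient.exists_rep Z
    have : IsEmpty ((point G).sub ⊥).carrier := ⟨fun x => x.2⟩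
    exact ⟨Z, (point G).sub ⊥, by rw [of_isEmpty ((point G).sub ⊥), sub_zero]; rfl⟩
  | neg Z h =>
    obtain ⟨X, Y, h⟩ := h
    exact ⟨Y, X, by rw [map_neg, h, neg_sub]⟩
  | add a b ha hb =>
    obtain ⟨X, Y, h⟩ := ha
    obtain ⟨X', Y', h'⟩ := hb
    exact ⟨X.sum X', Y.sum Y', by rw [map_add, h, h', of_sum, of_sum]; abel⟩

end BurnsideRing

namespace FinGSet

open MulAction

variable {G : Type u} [Group G]

/-- The orbit of a point, as a stable subset. -/
def orbitSub (X : FinGSet G) (x : X.carrier) : SubMulAction G X.carrier where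
  carrier := orbit G x
  smul_mem' g _ h := mem_orbit_of_mem_orbit g h

theorem iso_sub_compl (X : FinGSet G) (S : SubMulAction G X.carrier) :
    Iso ((X.sub S).sum (X.sub Sᶜ)) X := by
  classical
  refine ⟨Equiv.Set.sumCompl (S : Set X.carrier), ?_⟩
  rintro g (x | x) <;> rfl

theorem iso_orbit (X Y : FinGSet G) (x : X.carrier) (y : Y.carrier)
    (h : stabilizer G x = stabilizer G y) : Iso (X.sub (X.orbitSub x)) (Y.sub (Y.orbitSub y)) := by
  refine ⟨(orbitEquivQuotientStabilizer G x).trans ((Subgroup.quotientEquivOfEq h).trans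
    (orbitEquivQuotientStabilizer G y).symm), ?_⟩
  have key : ∀ g : G, ((orbitEquivQuotientStabilizer G x).trans ((Subgroup.quotientEquivOfEq h).trans
      (orbitEquivQuotientStabilizer G y).symm)) ⟨g • x, mem_orbit x g⟩ = ⟨g • y, mem_orbit y g⟩ := by
    intro g
    have h1 : (⟨g • x, mem_orbit x g⟩ : orbit G x) =
        (orbitEquivQuotientStabilizer G x).symm (QuotientGroup.mk g) :=
      Subtype.ext (orbitEquivQuotientStabilizer_symm_apply G x g).symm
    rw [h1, Equiv.trans_apply, Equiv.apply_symm_apply, Equiv.trans_apply]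
    exact Subtype.ext (orbitEquivQuotientStabilizer_symm_apply G y g)
  rintro g ⟨_, ⟨a, rfl⟩⟩
  have h1 : g • (⟨a • x, mem_orbit x a⟩ : (X.sub (X.orbitSub x)).carrier) =
      ⟨(g * a) • x, mem_orbit x (g * a)⟩ := Subtype.ext (mul_smul g a x).symm
  have h2 : g • (⟨a • y, mem_orbit y a⟩ : (Y.sub (Y.orbitSub y)).carrier) =
      ⟨(g * a) • y, mem_orbit y (g * a)⟩ := Subtype.ext (mul_smul g a y).symm
  exact (congrArg _ h1).trans ((key (g * a)).trans (h2.symm.trans (congrArg (g • ·) (key a).symm)))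

theorem iso_sum {X X' Y Y' : FinGSet G} (h : Iso X X') (h' : Iso Y Y') :
    Iso (X.sum Y) (X'.sum Y') := by
  obtain ⟨e, he⟩ := h
  obtain ⟨f, hf⟩ := h'
  refine ⟨Equiv.sumCongr e f, ?_⟩
  rintro g (x | x)
  · exact congrArg Sum.inl (he g x)
  · exact congrArg Sum.inr (hf g x)

/-- A finite `G`-set is determined up to isomorphism by its numbers of fixed points. -/
theorem iso_of_mark_eq [Finite G] (X Y : FinGSet G) (h : ∀ U, mark U X = mark U Y) : Iso X Y := by
  induction hn : Nat.card X.carrier using Nat.strong_induction_on generalizing X Y with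
  | _ n ih =>
    subst hn
    rcases isEmpty_or_nonempty X.carrier with hX | hX
    · have h1 : ∀ Z : FinGSet G, mark ⊥ Z = Nat.card Z.carrier := fun Z => by
        have : fixedPoints (⊥ : Subgroup G) Z.carrier = Set.univ :=
          Set.eq_univ_of_forall fun z u => by
            rw [Subsingleton.elim u 1, one_smul]
        rw [mark, this, Nat.card_univ]
      have h2 := h ⊥
      rw [h1, h1, Nat.card_of_isEmpty, eq_comm, Finite.card_eq_zero_iff] at h2
      exact ⟨Equiv.equivOfIsEmpty _ _, fun g x => hX.elim x⟩
    · obtain ⟨x, hx⟩ := Finite.exists_max fun x : X.carrier => Nat.card (stabilizer G x)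
      have pos : ∀ (Z : FinGSet G) (z : Z.carrier), mark (stabilizer G z) Z ≠ 0 := fun Z z => by
        have : Nonempty (fixedPoints (stabilizer G z) Z.carrier) := ⟨⟨z, fun u => u.2⟩⟩
        exact Nat.card_pos.ne'
      have ex : ∀ (Z : FinGSet G) (U : Subgroup G), mark U Z ≠ 0 →
          ∃ z : Z.carrier, U ≤ stabilizer G z := fun Z U hU => by
        obtain ⟨⟨z, hz⟩⟩ := (Nat.card_ne_zero.1 hU).1
        exact ⟨z, fun u hu => hz ⟨u, hu⟩⟩
      obtain ⟨y, hy⟩ := ex Y _ (h (stabilizer G x) ▸ pos X x)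
      obtain ⟨x', hx'⟩ := ex X _ (h (stabilizer G y) ▸ pos Y y)
      have heq : stabilizer G x = stabilizer G y :=
        Subgroup.eq_of_le_of_card_ge hy ((Subgroup.card_le_of_le hx').trans (hx x'))
      have hor := iso_orbit X Y x y heq
      have hc : Iso (X.sub (X.orbitSub x)ᶜ) (Y.sub (Y.orbitSub y)ᶜ) := by
        refine ih _ ?_ _ _ ?_ rfl
        · refine Finite.card_subtype_lt (x := x) ?_
          exact fun hx => hx (mem_orbit_self x)
        · intro U
          have h1 := mark_congr U (iso_sub_compl X (X.orbitSub x))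
          have h2 := mark_congr U (iso_sub_compl Y (Y.orbitSub y))
          rw [mark_sum] at h1 h2
          have h3 := mark_congr U hor
          have h4 := h U
          omega
      exact ((iso_sub_compl X _).symm.trans (iso_sum hor hc)).trans (iso_sub_compl Y _)

end FinGSet

namespace BurnsideRing

open FinGSet MulAction

theorem ext_mark {G : Type u} [Group G] [Finite G] {x y : BurnsideRing G}
    (h : ∀ U, mark U x = mark U y) : x = y := by
  obtain ⟨X, Y, hXY⟩ := exists_sub (x - y)
  rw [← sub_eq_zero, hXY, sub_eq_zero]
  refine of_congr (iso_of_mark_eq X Y fun U => ?_)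
  have : mark U (x - y) = 0 := by rw [map_sub, h, sub_self]
  rw [hXY, map_sub, mark_of, mark_of, sub_eq_zero] at this
  exact_mod_cast this

open scoped Pointwise in
/-- The `G`-set of subsets of `G` with `d` elements, under left translation. -/
def subsets (G : Type u) [Group G] [Finite G] (d : ℕ) : FinGSet G :=
  FinGSet.sub ⟨Set G⟩
    { carrier := {A | A.ncard = d}
      smul_mem' := fun g A hA => (Set.ncard_smul_set g A).trans hA }

open scoped Pointwise in
theorem mem_fixedPoints_subsets {G : Type u} [Group G] [Finite G] {d : ℕ} (U : Subgroup G)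
    (A : (subsets G d).carrier) :
    A ∈ fixedPoints U (subsets G d).carrier ↔ ∀ a b, a * b⁻¹ ∈ U → b ∈ A.1 → a ∈ A.1 := by
  constructor
  · intro h a b hab hb
    have h1 : (a * b⁻¹) • A.1 = A.1 := congrArg Subtype.val (h ⟨_, hab⟩)
    rw [← h1]
    exact ⟨b, hb, by simp⟩
  · intro h u
    refine Subtype.ext ?_
    change u.1 • A.1 = A.1
    refine Set.eq_of_subset_of_ncard_le ?_ (Set.ncard_smul_set u.1 A.1).ge
    rintro _ ⟨b, hb, rfl⟩
    exact h _ b (by simp) hb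

theorem mark_subsets {C : Type v} {G : Type u} [Group C] [Group G] [Finite C] [Finite G]
    (h : Nat.card C = Nat.card G) (d : ℕ) (U : Subgroup G) (V : Subgroup C)
    (hUV : Nat.card V = Nat.card U) :
    FinGSet.mark U (subsets G d) = FinGSet.mark V (subsets C d) := by
  obtain ⟨e, he⟩ : ∃ e : G ≃ C, ∀ a b, a * b⁻¹ ∈ U ↔ e a * (e b)⁻¹ ∈ V := by
    have hq : Nat.card (G ⧸ U) = Nat.card (C ⧸ V) := by
      have h1 := Subgroup.card_eq_card_quotient_mul_card_subgroup U
      have h2 := Subgroup.card_eq_card_quotient_mul_card_subgroup V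
      rw [← h, h2, hUV] at h1
      exact (Nat.eq_of_mul_eq_mul_right Nat.card_pos h1).symm
    let f : G ≃ (G ⧸ U) × U := Subgroup.groupEquivQuotientProdSubgroup
    let f' : C ≃ (C ⧸ V) × V := Subgroup.groupEquivQuotientProdSubgroup
    have hf : ∀ a, (f a).1 = QuotientGroup.mk a := fun a => rfl
    have hf' : ∀ a, (f' a).1 = QuotientGroup.mk a := fun a => rfl
    let q : (G ⧸ U) ≃ (C ⧸ V) := (Finite.card_eq.1 hq).some
    let e := f.trans ((Equiv.prodCongr q (Finite.card_eq.1 hUV.symm).some).trans f'.symm)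
    have hE : ∀ a : G, (QuotientGroup.mk (e a) : C ⧸ V) = q (QuotientGroup.mk a) := fun a => by
      rw [← hf', ← hf]
      simp [e]
    refine ⟨(Equiv.inv G).trans (e.trans (Equiv.inv C)), fun a b => ?_⟩
    have h1 : a * b⁻¹ ∈ U ↔ (QuotientGroup.mk a⁻¹ : G ⧸ U) = QuotientGroup.mk b⁻¹ := by
      rw [QuotientGroup.eq, inv_inv]
    rw [h1, ← q.apply_eq_iff_eq, ← hE, ← hE, QuotientGroup.eq]
    simp
  refine Nat.card_congr (Equiv.subtypeEquiv (Equiv.subtypeEquiv (Equiv.Set.congr e) fun A => ?_)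
    fun A => ?_)
  · change A.ncard = d ↔ (e '' A).ncard = d
    rw [Set.ncard_image_of_injective A e.injective]
  · refine (mem_fixedPoints_subsets U A).trans (Iff.trans ?_ (mem_fixedPoints_subsets V _).symm)
    change _ ↔ ∀ a b, a * b⁻¹ ∈ V → b ∈ e '' A.1 → a ∈ e '' A.1
    constructor
    · rintro h3 a b hab ⟨b, hb, rfl⟩
      obtain ⟨a, rfl⟩ := e.surjective a
      exact ⟨a, h3 a b ((he a b).2 hab) hb, rfl⟩
    · intro h3 a b hab hb
      exact e.injective.mem_set_image.1 (h3 (e a) (e b) ((he a b).1 hab) ⟨b, hb, rfl⟩)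

theorem cyclic_unique {C : Type v} [CommGroup C] [IsCyclic C] [Finite C] (U V : Subgroup C)
    (h : Nat.card U = Nat.card V) : U = V := by
  have key : ∀ W : Subgroup C, W = (powMonoidHom (Nat.card W) : C →* C).ker := fun W => by
    refine Subgroup.eq_of_le_of_card_ge (fun w hw => ?_) ?_
    · rw [MonoidHom.mem_ker, powMonoidHom_apply]
      exact congrArg Subtype.val (pow_card_eq_one' (x := (⟨w, hw⟩ : W)))
    · rw [IsCyclic.card_powMonoidHom_ker]
      exact Nat.gcd_le_right _ Nat.card_pos
  rw [key U, key V, h]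

/-- The elements of `B(C)` for which the prescribed numbers of fixed points are realised
in `B(G)`. -/
def realised (C : Type v) (G : Type u) [Group C] [Group G] : AddSubgroup (BurnsideRing C) where
  carrier := {x | ∃ y : BurnsideRing G, ∀ (U : Subgroup G) (V : Subgroup C),
    Nat.card V = Nat.card U → mark U y = mark V x}
  zero_mem' := ⟨0, fun U V _ => by rw [map_zero, map_zero]⟩
  add_mem' := by
    rintro a b ⟨y, hy⟩ ⟨z, hz⟩
    exact ⟨y + z, fun U V h => by rw [map_add, map_add, hy U V h, hz U V h]⟩
  neg_mem' := by
    rintro a ⟨y, hy⟩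
    exact ⟨-y, fun U V h => by rw [map_neg, map_neg, hy U V h]⟩

theorem stabilizer_sub {G : Type u} [Group G] (X : FinGSet G) (S : SubMulAction G X.carrier)
    (z : (X.sub S).carrier) : stabilizer G z = stabilizer G z.1 := by
  ext g
  exact Subtype.ext_iff

open scoped Pointwise in
theorem stabilizer_subsets {C : Type v} [CommGroup C] [IsCyclic C] [Finite C] (D : Subgroup C)
    (y : (subsets C (Nat.card D)).carrier) (hy : y.1 = D) : stabilizer C y = D := by
  ext g
  have h1 : g ∈ stabilizer C y ↔ g • y.1 = y.1 := Subtype.ext_iff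
  rw [h1, hy]
  constructor
  · intro h
    have : g ∈ g • (D : Set C) := ⟨1, D.one_mem, mul_one g⟩
    rwa [h] at this
  · exact fun h => smul_coe_set h

open scoped Pointwise in
theorem stabilizer_lt {C : Type v} [CommGroup C] [IsCyclic C] [Finite C] (D : Subgroup C)
    (y : (subsets C (Nat.card D)).carrier) (hy : y.1 = D) (z : (subsets C (Nat.card D)).carrier)
    (hz : z ∉ orbit C y) : Nat.card (stabilizer C z) < Nat.card D := by
  have hz1 : z.1.ncard = Nat.card D := z.2
  obtain ⟨a, ha⟩ : z.1.Nonempty := by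
    rw [← Set.ncard_pos, hz1]
    exact Nat.card_pos
  have hsub : a • (stabilizer C z : Set C) ⊆ z.1 := by
    rintro _ ⟨g, hg, rfl⟩
    have h1 : g • z.1 = z.1 := congrArg Subtype.val hg
    rw [← h1]
    exact ⟨a, ha, mul_comm g a⟩
  have hcard : (a • (stabilizer C z : Set C)).ncard = Nat.card (stabilizer C z) := by
    rw [Set.ncard_smul_set]
    rfl
  refine lt_of_le_of_ne ?_ fun heq => hz ⟨a, ?_⟩
  · exact hcard.symm.le.trans ((Set.ncard_le_ncard hsub).trans hz1.le)
  · refine Subtype.ext ?_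
    have h1 : a • y.1 = a • (stabilizer C z : Set C) := by
      rw [hy]
      exact congrArg (fun W : Subgroup C => a • (W : Set C)) (cyclic_unique _ _ heq).symm
    exact h1.trans (Set.eq_of_subset_of_ncard_le hsub
      (hz1.trans (heq.symm.trans hcard.symm)).le)

theorem of_mem_realised {C : Type v} {G : Type u} [CommGroup C] [IsCyclic C] [Finite C] [Group G]
    [Finite G] (h : Nat.card C = Nat.card G) (k : ℕ) (X : FinGSet C)
    (hX : ∀ x : X.carrier, Nat.card (stabilizer C x) < k) : of X ∈ realised C G := by
  induction k using Nat.strong_induction_on generalizing X with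
  | _ k ihk =>
  induction hn : Nat.card X.carrier using Nat.strong_induction_on generalizing X with
  | _ n ih =>
  subst hn
  rcases isEmpty_or_nonempty X.carrier with he | ⟨⟨x⟩⟩
  · rw [of_isEmpty]
    exact zero_mem _
  · rw [← of_congr (iso_sub_compl X (X.orbitSub x)), of_sum]
    refine add_mem ?_ (ih _ ?_ _ ?_ rfl)
    · let y : (subsets C (Nat.card (stabilizer C x))).carrier := ⟨(stabilizer C x : Set C), rfl⟩
      rw [of_congr (iso_orbit X _ x y (stabilizer_subsets _ y rfl).symm)]
      have h1 := of_sum ((subsets C (Nat.card (stabilizer C x))).sub (orbitSub _ y)) ((subsets C (Nat.card (stabilizer C x))).sub (orbitSub _ y)ᶜ)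
      rw [of_congr (iso_sub_compl _ _), eq_comm, ← eq_sub_iff_add_eq] at h1
      rw [h1]
      refine sub_mem ⟨of (subsets G (Nat.card (stabilizer C x))), fun U V hV => ?_⟩ (ihk _ (hX x) _ fun z => ?_)
      · rw [mark_of, mark_of, mark_subsets h _ U V hV]
      · rw [stabilizer_sub]
        exact stabilizer_lt _ y rfl z.1 z.2
    · refine Finite.card_subtype_lt (x := x) ?_
      exact fun hx => hx (mem_orbit_self x)
    · intro z
      rw [stabilizer_sub]
      exact hX z.1

theorem exists_frobeniusWielandt {C : Type v} {G : Type u} [CommGroup C] [IsCyclic C] [Finite C]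
    [Group G] [Finite G] (h : Nat.card C = Nat.card G) :
    ∃! α : BurnsideRing C →+* BurnsideRing G, ∀ (x : BurnsideRing C) (U : Subgroup G)
      (V : Subgroup C), Nat.card V = Nat.card U → mark U (α x) = mark V x := by
  have hall : ∀ x : BurnsideRing C, ∃ y : BurnsideRing G, ∀ (U : Subgroup G) (V : Subgroup C),
      Nat.card V = Nat.card U → mark U y = mark V x := by
    intro x
    obtain ⟨X, Y, rfl⟩ := exists_sub x
    have key : ∀ Z : FinGSet C, of Z ∈ realised C G := fun Z =>
      of_mem_realised h (Nat.card C + 1) Z fun z => Nat.lt_succ_of_le (Subgroup.card_le_card_group _)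
    exact sub_mem (key X) (key Y)
  have hV : ∀ U : Subgroup G, ∃ V : Subgroup C, Nat.card V = Nat.card U := fun U =>
    ⟨(powMonoidHom (Nat.card U) : C →* C).ker, by
      rw [IsCyclic.card_powMonoidHom_ker, h]
      exact Nat.gcd_eq_right (Subgroup.card_subgroup_dvd_card U)⟩
  choose a ha using hall
  have uniq : ∀ x y, (∀ (U : Subgroup G) (V : Subgroup C), Nat.card V = Nat.card U →
      mark U y = mark V x) → a x = y := fun x y hy => ext_mark fun U => by
    obtain ⟨V, hV⟩ := hV U
    rw [ha x U V hV, hy U V hV]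
  refine ⟨{ toFun := a, map_one' := ?_, map_mul' := ?_, map_zero' := ?_, map_add' := ?_ },
    fun x => ha x, fun β hβ => RingHom.ext fun x => (uniq x (β x) (hβ x)).symm⟩
  · exact uniq _ _ fun U V _ => by rw [map_one, map_one]
  · exact fun x y => uniq _ _ fun U V h => by rw [map_mul, map_mul, ha x U V h, ha y U V h]
  · exact uniq _ _ fun U V _ => by rw [map_zero, map_zero]
  · exact fun x y => uniq _ _ fun U V h => by rw [map_add, map_add, ha x U V h, ha y U V h]

/-- The Frobenius-Wielandt morphism `α^G : B(C) → B(G)`, for a cyclic group `C` of order `|G|`: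
the unique ring homomorphism such that `|α(x)^U| = |x^V|` whenever `U ≤ G` and `V ≤ C` have the
same order (that is, when `V` is the unique subgroup of `C` of order `|U|`). -/
noncomputable def frobeniusWielandt (C : Type v) (G : Type u) [CommGroup C] [IsCyclic C] [Finite C]
    [Group G] [Finite G] (h : Nat.card C = Nat.card G) : BurnsideRing C →+* BurnsideRing G :=
  (exists_frobeniusWielandt h).choose

theorem mark_frobeniusWielandt {C : Type v} {G : Type u} [CommGroup C] [IsCyclic C] [Finite C]
    [Group G] [Finite G] (h : Nat.card C = Nat.card G) (x : BurnsideRing C) (U : Subgroup G)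
    (V : Subgroup C) (hV : Nat.card V = Nat.card U) :
    mark U (frobeniusWielandt C G h x) = mark V x :=
  (exists_frobeniusWielandt h).choose_spec.1 x U V hV

end BurnsideRing

section Deflation

open MulAction

variable {G : Type u} [Group G]

/-- The `G/N`-action `(gN) • [x] = [g • x]` on the set of `N`-orbits of a `G`-set. -/
@[reducible] def deflationAction (N : Subgroup G) [N.Normal] (X : Type*) [MulAction G X] :
    MulAction (G ⧸ N) (orbitRel.Quotient N X) where
  smul := Quotient.map₂ (sa := QuotientGroup.leftRel N) (sb := orbitRel N X)
    (sc := orbitRel N X) (· • ·) (by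
      rintro a b hab x y ⟨n, rfl⟩
      have hab' : a⁻¹ * b ∈ N := QuotientGroup.leftRel_apply.1 hab
      have hm : a * n * b⁻¹ ∈ N := by
        have := Subgroup.Normal.conj_mem ‹N.Normal› _ (N.mul_mem n.2 (N.inv_mem hab')) a
        simpa [mul_assoc] using this
      exact ⟨⟨a * n * b⁻¹, hm⟩, by simp [Subgroup.smul_def, mul_smul]⟩)
  one_smul := by
    rintro ⟨x⟩
    exact congrArg (Quotient.mk _) (one_smul G x)
  mul_smul := by
    rintro ⟨a⟩ ⟨b⟩ ⟨x⟩
    exact congrArg (Quotient.mk _) (mul_smul a b x)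

/-- The `G/N`-set `X/∼` of `N`-orbits of the `G`-set `X`. -/
def FinGSet.deflation (N : Subgroup G) [N.Normal] (X : FinGSet G) : FinGSet (G ⧸ N) where
  carrier := orbitRel.Quotient N X.carrier
  action := deflationAction N X.carrier
  finite := Quotient.finite _

/-- Deflation `Def^G_{G/N} : B(G) → B(G/N)`, the additive map with `[X] ↦ [X/∼]`, where `∼` is
the relation `x ∼ nx` for `n ∈ N`. -/
def BurnsideRing.deflation (N : Subgroup G) [N.Normal] : BurnsideRing G →+ BurnsideRing (G ⧸ N) :=
  liftAdd (fun X => of (X.deflation N))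
    (by
      rintro X Y ⟨e, he⟩
      refine of_congr ⟨Quotient.congr e fun x y => exists_congr fun n => ?_, ?_⟩
      · change n.1 • y = x ↔ n.1 • e y = e x
        rw [← he, e.apply_eq_iff_eq]
      · rintro ⟨g⟩ ⟨x⟩
        exact congrArg (Quotient.mk _) (he g x))
    (by
      intro X Y
      rw [← of_sum]
      refine of_congr ⟨
        { toFun := Quotient.lift (Sum.map (Quotient.mk (orbitRel N X.carrier))
            (Quotient.mk (orbitRel N Y.carrier))) ?_
          invFun := Sum.elim
            (Quotient.map' (s₂ := orbitRel N (X.sum Y).carrier) Sum.inl ?_)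
            (Quotient.map' (s₂ := orbitRel N (X.sum Y).carrier) Sum.inr ?_)
          left_inv := ?_
          right_inv := ?_ }, ?_⟩
      · rintro _ (y | y) ⟨n, rfl⟩
        · exact congrArg Sum.inl (Quotient.sound ⟨n, rfl⟩)
        · exact congrArg Sum.inr (Quotient.sound ⟨n, rfl⟩)
      · rintro _ y ⟨n, rfl⟩
        exact ⟨n, rfl⟩
      · rintro _ y ⟨n, rfl⟩
        exact ⟨n, rfl⟩
      · rintro ⟨x | x⟩ <;> rfl
      · rintro (x | x) <;> induction x using Quotient.inductionOn <;> rfl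
      · rintro ⟨g⟩ ⟨x | x⟩ <;> rfl)

theorem BurnsideRing.deflation_of (N : Subgroup G) [N.Normal] (X : FinGSet G) :
    deflation N (of X) = of (X.deflation N) :=
  liftAdd_of _ _ _ X

end Deflation

/-- The subgroup `C_d` of a finite cyclic group `C`, of order `d` when `d` divides `|C|`. -/
def cyclicSubgroup (C : Type v) [CommGroup C] (d : ℕ) : Subgroup C := (powMonoidHom d : C →* C).ker

theorem card_cyclicSubgroup (C : Type v) [CommGroup C] [IsCyclic C] [Finite C] (d : ℕ)
    (hd : d ∣ Nat.card C) : Nat.card (cyclicSubgroup C d) = d := by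
  rw [cyclicSubgroup, IsCyclic.card_powMonoidHom_ker]
  exact Nat.gcd_eq_right hd

theorem card_cyclicSubgroup_eq {C : Type v} {G : Type u} [CommGroup C] [IsCyclic C] [Finite C]
    [Group G] (h : Nat.card C = Nat.card G) (T : Subgroup G) :
    Nat.card (cyclicSubgroup C (Nat.card T)) = Nat.card T :=
  card_cyclicSubgroup C _ (h ▸ Subgroup.card_subgroup_dvd_card T)

section Commutation

variable {C : Type v} {G : Type u} [CommGroup C] [IsCyclic C] [Finite C] [Group G] [Finite G]

theorem card_quotient_cyclicSubgroup (h : Nat.card C = Nat.card G) (N : Subgroup G) :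
    Nat.card (C ⧸ cyclicSubgroup C (Nat.card N)) = Nat.card (G ⧸ N) := by
  have h1 := Subgroup.card_eq_card_quotient_mul_card_subgroup N
  have h2 := Subgroup.card_eq_card_quotient_mul_card_subgroup (cyclicSubgroup C (Nat.card N))
  rw [card_cyclicSubgroup_eq h, h, h1] at h2
  exact (Nat.eq_of_mul_eq_mul_right Nat.card_pos h2).symm

/-- For `G`, a normal subgroup `N` and a cyclic group `C` of order `|G|`, the Frobenius-Wielandt
morphism commutes with deflation:
`Def^G_{G/N} ∘ α^G = α^{G/N} ∘ Def^C_{C/C_N}`, where `C_N` is the subgroup of `C` of order `|N|`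
and `C/C_N` serves as the cyclic group of order `|G/N|`. -/
def FWCommutesWithDeflation (h : Nat.card C = Nat.card G) (N : Subgroup G) [N.Normal] : Prop :=
  ∀ x : BurnsideRing C,
    BurnsideRing.deflation N (BurnsideRing.frobeniusWielandt C G h x) =
      BurnsideRing.frobeniusWielandt (C ⧸ cyclicSubgroup C (Nat.card N)) (G ⧸ N)
        (card_quotient_cyclicSubgroup h N)
        (BurnsideRing.deflation (cyclicSubgroup C (Nat.card N)) x)

end Commutation

/-! Every map in the identity is additive and an element of a Burnside ring is determined by its
marks, which are integers. It therefore suffices to verify the identity for a nonzero multiple of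
each `x` in `B(C_T)`. Restriction `B(C) → B(C_T)` is not surjective in general, but its image
contains `[C : C_T] • x` (`index_nsmul_mem_range_res`): since `C` is abelian, `C/W` with `W ≤ C_T`
restricts to `[C : C_T]` copies of `C_T/W`. So one may take `x` to be the restriction of some `y` in
`B(C)`.

For restrictions the identity descends from `G`. The FW morphism commutes with restriction
(`frobeniusWielandt_res`), and the mark at `U ≤ T/N` of a deflated restriction is the mark of the
deflation at the image of `U` in `G/N` (`mark_deflation_res`). The hypothesis for `G`, applied to
`y`, turns the left side into a mark of `α^{G/N}(Def y)`. Both sides are then marks of `Def y` at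
subgroups of `C/C_N` of order `|U|`, as `T/N → G/N` and `C_T/C_N → C/C_N` are injective. -/

namespace FinGSet

open MulAction

variable {G : Type u} [Group G]

/-! ### Marks of restricted and deflated sets. -/

/-- The restriction of a `G`-set to a subgroup `H`. -/
def res (H : Subgroup G) (X : FinGSet G) : FinGSet H := ⟨X.carrier⟩

theorem mark_res (H : Subgroup G) (U : Subgroup H) (X : FinGSet G) :
    mark U (X.res H) = mark (U.map H.subtype) X := by
  refine Nat.card_congr (Equiv.subtypeEquivRight fun x => ?_)
  constructor
  · rintro hx ⟨_, u, hu, rfl⟩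
    exact hx ⟨u, hu⟩
  · intro hx u
    exact hx ⟨_, Subgroup.mem_map_of_mem H.subtype u.2⟩

/-- The `N`-orbits on `X` are the same whether `N` is viewed inside `T` or inside `G`, so both
deflations have the same points, with `T/N` acting through `T/N → G/N`. -/
theorem mark_deflation_res (N T : Subgroup G) [N.Normal] (hNT : N ≤ T)
    (U : Subgroup (T ⧸ N.subgroupOf T)) (X : FinGSet G) :
    mark U ((X.res T).deflation (N.subgroupOf T)) =
      mark (U.map (QuotientGroup.map (N.subgroupOf T) N T.subtype le_rfl)) (X.deflation N) := by
  let e : ((X.res T).deflation (N.subgroupOf T)).carrier ≃ (X.deflation N).carrier :=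
    Quotient.congr (ra := orbitRel (N.subgroupOf T) (X.res T).carrier)
      (rb := orbitRel N X.carrier) (Equiv.refl X.carrier) fun x y => by
        constructor
        · rintro ⟨n, rfl⟩
          exact ⟨⟨n.1.1, n.2⟩, rfl⟩
        -- The only place where `N ≤ T` matters: otherwise `N ∩ T` could have smaller orbits than
        -- `N`.
        · rintro ⟨n, hn⟩
          exact ⟨⟨⟨n.1, hNT n.2⟩, n.2⟩, hn⟩
  have he : ∀ g x, e (g • x) =
      QuotientGroup.map (N.subgroupOf T) N T.subtype le_rfl g • e x := by
    rintro ⟨g⟩ ⟨x⟩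
    rfl
  refine Nat.card_congr (e.subtypeEquiv fun x => ?_)
  constructor
  · rintro hx ⟨_, u, hu, rfl⟩
    exact (he u x).symm.trans (congrArg e (hx ⟨u, hu⟩))
  · intro hx u
    exact e.injective ((he u.1 x).trans (hx ⟨_, Subgroup.mem_map_of_mem _ u.2⟩))

-- Used to compare sets over an abelian group, where points of one orbit share their stabilizer:
-- such a set is known from its stabilizer and its size.
open Classical in
theorem mark_of_stabilizer_eq (X : FinGSet G) (W : Subgroup G)
    (hW : ∀ x : X.carrier, stabilizer G x = W) (U : Subgroup G) :
    mark U X = if U ≤ W then Nat.card X.carrier else 0 := by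
  have key : ∀ x : X.carrier, x ∈ fixedPoints U X.carrier ↔ U ≤ W := fun x => by
    rw [← hW x]
    exact ⟨fun h u hu => h ⟨u, hu⟩, fun h u => h u.2⟩
  split_ifs with h
  · exact (Nat.card_congr (Equiv.subtypeUnivEquiv fun x => (key x).2 h))
  · have : IsEmpty (fixedPoints U X.carrier) := ⟨fun x => h ((key x.1).1 x.2)⟩
    exact Nat.card_of_isEmpty

end FinGSet

/-! ### Restriction on Burnside rings. -/

namespace BurnsideRing

open FinGSet MulAction

/-- Restriction `B(G) → B(H)` to a subgroup. -/
def res {G : Type u} [Group G] (H : Subgroup G) : BurnsideRing G →+ BurnsideRing H :=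
  liftAdd (fun X => of (X.res H))
    (fun _ _ ⟨e, he⟩ => of_congr ⟨e, fun g x => he g.1 x⟩)
    (fun X Y => by
      rw [← of_sum]
      exact of_congr ⟨Equiv.refl _, by rintro g (x | x) <;> rfl⟩)

theorem res_of {G : Type u} [Group G] (H : Subgroup G) (X : FinGSet G) :
    res H (of X) = of (X.res H) :=
  liftAdd_of _ _ _ X

theorem mark_res {G : Type u} [Group G] (H : Subgroup G) (U : Subgroup H) (x : BurnsideRing G) :
    mark U (res H x) = mark (U.map H.subtype) x := by
  obtain ⟨X, Y, rfl⟩ := exists_sub x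
  simp only [map_sub, res_of, mark_of, FinGSet.mark_res]

/-- `M` is kept apart from `N.subgroupOf T` because on the cyclic side it is given as a torsion
subgroup of `C_T`, equal to the intersection only propositionally, and the type `T ⧸ M` depends on
it. -/
theorem mark_deflation_res {G : Type u} [Group G] (N T : Subgroup G) [N.Normal] (hNT : N ≤ T)
    (M : Subgroup T) [M.Normal] (hM : M = N.subgroupOf T) (U : Subgroup (T ⧸ M))
    (x : BurnsideRing G) :
    mark U (deflation M (res T x)) =
      mark (U.map (QuotientGroup.map M N T.subtype hM.le)) (deflation N x) := by
  subst hM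
  obtain ⟨X, Y, rfl⟩ := exists_sub x
  simp only [map_sub, res_of, mark_of, deflation_of, FinGSet.mark_deflation_res N T hNT]

theorem card_map_quotient {G : Type u} [Group G] (N T : Subgroup G) [N.Normal]
    (M : Subgroup T) [M.Normal] (hM : M = N.subgroupOf T) (U : Subgroup (T ⧸ M)) :
    Nat.card (U.map (QuotientGroup.map M N T.subtype hM.le)) = Nat.card U := by
  refine Subgroup.card_map_of_injective ?_
  rw [injective_iff_map_eq_one]
  rintro ⟨g⟩ hg
  refine (QuotientGroup.eq_one_iff g).2 ?_
  rw [hM]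
  exact (QuotientGroup.eq_one_iff (N := N) g.1).1 hg

/-! ### Restrictions from an abelian group, and the FW morphism on restrictions. -/

/-- Over an abelian group, every class is rationally a restriction. -/
theorem index_nsmul_mem_range_res {C : Type v} [CommGroup C] [Finite C] (H : Subgroup C)
    (x : BurnsideRing H) : H.index • x ∈ (res H).range := by
  suffices key : ∀ X : FinGSet H, H.index • of X ∈ (res H).range by
    obtain ⟨X, Y, rfl⟩ := exists_sub x
    rw [nsmul_sub]
    exact sub_mem (key X) (key Y)
  intro X
  induction hn : Nat.card X.carrier using Nat.strong_induction_on generalizing X with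
  | _ n ih =>
  subst hn
  rcases isEmpty_or_nonempty X.carrier with he | ⟨⟨x⟩⟩
  · rw [of_isEmpty, nsmul_zero]
    exact zero_mem _
  -- Splitting off the orbit of `x` leaves a smaller set, so only a transitive set `H/W` remains to
  -- be treated.
  rw [← of_congr (iso_sub_compl X (X.orbitSub x)), of_sum, nsmul_add]
  refine add_mem ?_ (ih _ (Finite.card_subtype_lt (x := x) fun hx => hx (mem_orbit_self x)) _ rfl)
  let W := stabilizer H x
  -- As an `H`-set, `C/W` has every stabilizer equal to `W` and `[C : H]` times as many points as
  -- `H/W`.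
  let Y : FinGSet C := ⟨C ⧸ W.map H.subtype⟩
  refine ⟨of Y, ext_mark fun U => ?_⟩
  have hY : ∀ y : (Y.res H).carrier, stabilizer H y = W := by
    intro y
    obtain ⟨c, rfl⟩ := QuotientGroup.mk_surjective (s := W.map H.subtype) y
    ext h
    rw [mem_stabilizer_iff]
    have h1 : (h • (QuotientGroup.mk c : C ⧸ W.map H.subtype) = QuotientGroup.mk c) ↔
        h.1 ∈ W.map H.subtype := by
      change (QuotientGroup.mk (h.1 * c) : C ⧸ W.map H.subtype) = QuotientGroup.mk c ↔ _
      -- Commutativity of `C` makes the stabilizer of `cW` independent of `c`.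
      rw [eq_comm, QuotientGroup.eq, mul_comm h.1, inv_mul_cancel_left]
    refine h1.trans ⟨?_, fun hh => ⟨h, hh, rfl⟩⟩
    rintro ⟨k, hk, hkh⟩
    rwa [← Subtype.ext hkh]
  have hX : ∀ y : (X.sub (X.orbitSub x)).carrier, stabilizer H y = W := by
    rintro ⟨_, a, rfl⟩
    refine (stabilizer_sub X (X.orbitSub x) _).trans ?_
    exact stabilizer_smul_eq_right a x
  have cY : Nat.card (Y.res H).carrier = W.index * H.index := Subgroup.index_map_subtype W
  have cX : Nat.card (X.sub (X.orbitSub x)).carrier = W.index :=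
    Nat.card_congr (orbitEquivQuotientStabilizer H x)
  rw [map_nsmul, res_of, mark_of, mark_of, mark_of_stabilizer_eq _ W hY,
    mark_of_stabilizer_eq _ W hX, cY, cX]
  split_ifs
  · simp [mul_comm]
  · simp

/-- The Frobenius-Wielandt morphism commutes with restriction. -/
theorem frobeniusWielandt_res {C : Type v} {G : Type u} [CommGroup C] [IsCyclic C] [Finite C]
    [Group G] [Finite G] (h : Nat.card C = Nat.card G) (T : Subgroup G) (D : Subgroup C)
    (hD : Nat.card D = Nat.card T) (x : BurnsideRing C) :
    frobeniusWielandt D T hD (res D x) = res T (frobeniusWielandt C G h x) := by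
  refine ext_mark fun U => ?_
  have hV := card_cyclicSubgroup_eq hD U
  rw [mark_frobeniusWielandt hD _ U _ hV, mark_res, mark_res]
  -- Both sides are now marks attached to the images of `U` in `G` and of its partner in `C`; these
  -- images again have equal order.
  refine (mark_frobeniusWielandt h _ _ _ ?_).symm
  rw [Subgroup.card_map_of_injective D.subtype_injective,
    Subgroup.card_map_of_injective T.subtype_injective, hV]

end BurnsideRing

/-! ### Compatibility of the subgroups `C_d`, and descent from `G` to `T`. -/

theorem cyclicSubgroup_subgroupOf {C : Type v} [CommGroup C] (D : Subgroup C) (d : ℕ) :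
    cyclicSubgroup D d = (cyclicSubgroup C d).subgroupOf D := by
  ext x
  exact Subtype.ext_iff

theorem cyclicSubgroup_mono {C : Type v} [CommGroup C] {d e : ℕ} (h : d ∣ e) :
    cyclicSubgroup C d ≤ cyclicSubgroup C e := by
  obtain ⟨k, rfl⟩ := h
  intro x hx
  change x ^ (d * k) = 1
  rw [pow_mul, show x ^ d = 1 from hx, one_pow]

open BurnsideRing in
theorem mainTheorem7 {C : Type v} {G : Type u} [CommGroup C] [IsCyclic C] [Finite C] [Group G]
    [Finite G] (h : Nat.card C = Nat.card G) (N : Subgroup G) [N.Normal]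
    (hcomm : FWCommutesWithDeflation h N) (T : Subgroup G) (hNT : N ≤ T) :
    FWCommutesWithDeflation (C := cyclicSubgroup C (Nat.card T)) (G := T)
      (card_cyclicSubgroup_eq h T) (N.subgroupOf T) := by
  intro x
  have hcard : Nat.card (N.subgroupOf T) = Nat.card N :=
    Nat.card_congr (Subgroup.subgroupOfEquivOfLe hNT).toEquiv
  -- The goal forms `C_N` inside `C_T`; this matches it with `C_N` formed inside `C`.
  have hM : cyclicSubgroup (cyclicSubgroup C (Nat.card T)) (Nat.card (N.subgroupOf T)) =
      (cyclicSubgroup C (Nat.card N)).subgroupOf (cyclicSubgroup C (Nat.card T)) := by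
    rw [hcard, cyclicSubgroup_subgroupOf]
  obtain ⟨y, hy⟩ := index_nsmul_mem_range_res (cyclicSubgroup C (Nat.card T)) x
  refine ext_mark fun U => ?_
  -- Marks lie in `ℤ`, which is torsion-free, so multiplying by the nonzero index `[C : C_T]` loses
  -- nothing and `x` can be replaced by `res y`.
  refine nsmul_right_injective (Subgroup.FiniteIndex.index_ne_zero
    (H := cyclicSubgroup C (Nat.card T))) ?_
  have hV := card_cyclicSubgroup_eq
    (card_quotient_cyclicSubgroup (card_cyclicSubgroup_eq h T) (N.subgroupOf T)) U
  simp only [← map_nsmul, ← hy]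
  rw [frobeniusWielandt_res h, mark_deflation_res N T hNT _ rfl, hcomm y,
    mark_frobeniusWielandt _ _ U _ hV,
    mark_deflation_res _ _ (cyclicSubgroup_mono (Subgroup.card_dvd_of_le hNT)) _ hM]
  -- What remains is the defining property of `α^{G/N}` at the image of `U`, with the image in
  -- `C/C_N` of the subgroup of order `|U|` as partner.
  refine mark_frobeniusWielandt _ _ _ _ ?_
  rw [card_map_quotient _ _ _ hM, card_map_quotient _ _ _ rfl, hV]
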